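/- Let $p\in[1/2,1)$ and $q=1-p$. Two players play independent rounds, each of which is won by Player 1 with probability $p$ and by Player 2 with probability $q$. For a positive integer $n$, the game is stopped at the first time at which one of the players has won exactly $n$ rounds (so after at most $2n-1$ rounds), and this player is the overall winner. Let $W_{n,p}\in\{0,1,\dots,n-1\}$ be the number of rounds won by the loser, and let $Z_{n,p}$ be the net profit of Player 1, that is, $Z_{n,p}=n-W_{n,p}$ if Player 1 is the overall winner and $Z_{n,p}=W_{n,p}-n$ if Player 2 is the overall winner. Then: (a) For all integers $n\ge 1$ and $0\le k<n$, $$\mathbb{P}(W_{n,p}=k)=\binom{n+k-1}{n-1}q^k p^n+\alpha,$$ where $\alpha=\alpha_{n,k,p}$ is a real number with $|\alpha|\le (4pq)^n$. (b) For fixed $p$, as $n\to\infty$, $$\frac{pZ_{n,p}-(p-q)n}{\sqrt{nq}}\to \mathcal{N}(0,1)\quad\text{in distribution.}$$ -/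

import Mathlib

/-! A record of rounds is a sequence `s : ℕ → Bool`, where `s i = true` means that round `i + 1` is
won by Player 1 and `s i = false` means that it is won by Player 2. -/

namespace FirstToWin

/-- The number of wins of Player 1 in the first `m` rounds. -/
def winsOne (s : ℕ → Bool) (m : ℕ) : ℕ :=
  ((Finset.range m).filter (fun i => s i = true)).card

/-- The number of wins of Player 2 in the first `m` rounds. -/
def winsTwo (s : ℕ → Bool) (m : ℕ) : ℕ :=
  ((Finset.range m).filter (fun i => s i = false)).card

/-- After `m` rounds, exactly `m` wins have been distributed. -/
theorem winsOne_add_winsTwo (s : ℕ → Bool) (m : ℕ) : winsOne s m + winsTwo s m = m := by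
  induction m with
  | zero => simp [winsOne, winsTwo]
  | succ m ih =>
    unfold winsOne winsTwo at *
    rw [Finset.range_add_one, Finset.filter_insert, Finset.filter_insert]
    cases h : s m <;> simp <;> omega

/-- Some player always reaches `n` wins, after at most `2 n - 1` rounds. -/
theorem exists_winner (n : ℕ) (s : ℕ → Bool) :
    ∃ m ≤ 2 * n - 1, winsOne s m = n ∨ winsTwo s m = n := by
  have hex : ∃ m, n ≤ winsOne s m ∨ n ≤ winsTwo s m :=
    ⟨2 * n - 1, by have := winsOne_add_winsTwo s (2 * n - 1); omega⟩
  refine ⟨Nat.find hex, Nat.find_min' hex ?_, ?_⟩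
  · have := winsOne_add_winsTwo s (2 * n - 1)
    omega
  · have hs := Nat.find_spec hex
    rcases hm : Nat.find hex with _ | m
    · rw [hm] at hs
      simp only [winsOne, winsTwo, Finset.range_zero, Finset.filter_empty, Finset.card_empty] at *
      omega
    · have hlt := Nat.find_min hex (m := m) (by omega)
      rw [hm] at hs
      have h1 : winsOne s (m + 1) ≤ winsOne s m + 1 := by
        unfold winsOne
        rw [Finset.range_add_one, Finset.filter_insert]
        split_ifs <;> simp
      have h2 : winsTwo s (m + 1) ≤ winsTwo s m + 1 := by
        unfold winsTwo
        rw [Finset.range_add_one, Finset.filter_insert]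
        split_ifs <;> simp
      omega

/-- The number of rounds of the game: the first time at which one of the players has won exactly
`n` rounds. The set is never empty, by `exists_winner`. -/
noncomputable def gameLength (n : ℕ) (s : ℕ → Bool) : ℕ :=
  sInf {m : ℕ | winsOne s m = n ∨ winsTwo s m = n}

/-- Player 1 is the overall winner: at the end of the game Player 1 has `n` wins. -/
def PlayerOneWon (n : ℕ) (s : ℕ → Bool) : Prop :=
  winsOne s (gameLength n s) = n

open Classical in
/-- `W`: the number of rounds won by the loser of the game. -/
noncomputable def loserWins (n : ℕ) (s : ℕ → Bool) : ℕ :=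
  if PlayerOneWon n s then winsTwo s (gameLength n s) else winsOne s (gameLength n s)

open Classical in
/-- `Z`: the net profit of Player 1, i.e. `n - W` if Player 1 won and `W - n` if Player 2 won. -/
noncomputable def netProfit (n : ℕ) (s : ℕ → Bool) : ℤ :=
  if PlayerOneWon n s then (n : ℤ) - loserWins n s else (loserWins n s : ℤ) - n

end FirstToWin

namespace FirstToWin

open MeasureTheory ProbabilityTheory Filter Set
open scoped Topology

/-! For (a), the loser ends with `k < n` wins exactly when round `n + k` is decisive: the eventual
winner has `n - 1` wins before it and takes it. Independence of that round from the earlier ones and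
the binomial law give one term per winner (`measureReal_loserWins_eq`). The error `α` is the term in
which Player 2 wins, bounded in `choose_mul_pow_le`.

For (b), the stopping time is removed. For `j > 0`, a profit of at least `j` means that Player 1 has
`n` wins within `2 n - j` rounds (`le_netProfit_iff`), and a similar equivalence holds for
nonpositive thresholds. So the event that the normalized profit is at least `x` becomes an event
about a binomial variable after a deterministic number `m n ∼ n / p` of rounds
(`exists_winsOne_threshold`). The central limit theorem along `m n`, with Slutsky's lemma absorbing
the moving threshold, gives the limit of its probability. -/

theorem winsOne_succ (s : ℕ → Bool) (m : ℕ) :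
    winsOne s (m + 1) = winsOne s m + if s m = true then 1 else 0 := by
  unfold winsOne
  rw [Finset.range_add_one, Finset.filter_insert]
  split_ifs <;> simp

theorem winsTwo_succ (s : ℕ → Bool) (m : ℕ) :
    winsTwo s (m + 1) = winsTwo s m + if s m = true then 0 else 1 := by
  unfold winsTwo
  rw [Finset.range_add_one, Finset.filter_insert]
  split_ifs <;> simp_all

theorem winsOne_zero (s : ℕ → Bool) : winsOne s 0 = 0 := by simp [winsOne]

theorem winsTwo_zero (s : ℕ → Bool) : winsTwo s 0 = 0 := by simp [winsTwo]

theorem winsOne_mono (s : ℕ → Bool) : Monotone (winsOne s) :=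
  monotone_nat_of_le_succ fun m => by rw [winsOne_succ]; omega

theorem winsTwo_mono (s : ℕ → Bool) : Monotone (winsTwo s) :=
  monotone_nat_of_le_succ fun m => by rw [winsTwo_succ]; omega

theorem winsOne_eq_sum (s : ℕ → Bool) (m : ℕ) :
    (winsOne s m : ℝ) = ∑ i ∈ Finset.range m, if s i = true then 1 else 0 := by
  simp [winsOne]

/-- A function on `ℕ` starting at `0` with steps at most `1` attains every value below each of
its values. -/
theorem exists_le_eq_of_le {f : ℕ → ℕ} (h0 : f 0 = 0) (hs : ∀ m, f (m + 1) ≤ f m + 1)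
    {n m : ℕ} (h : n ≤ f m) : ∃ k ≤ m, f k = n := by
  induction m with
  | zero => exact ⟨0, le_rfl, by omega⟩
  | succ m ih =>
    rcases Nat.lt_or_ge (f m) n with hlt | hge
    · exact ⟨m + 1, le_rfl, by have := hs m; omega⟩
    · obtain ⟨k, hk, hkn⟩ := ih hge
      exact ⟨k, by omega, hkn⟩

/-! ### Combinatorics of a fixed record of rounds -/

theorem gameLength_spec (n : ℕ) (s : ℕ → Bool) :
    winsOne s (gameLength n s) = n ∨ winsTwo s (gameLength n s) = n := by
  obtain ⟨m, -, hm⟩ := exists_winner n s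
  exact Nat.sInf_mem (s := {m : ℕ | winsOne s m = n ∨ winsTwo s m = n}) ⟨m, hm⟩

theorem gameLength_le_of_le_winsOne {n m : ℕ} {s : ℕ → Bool} (h : n ≤ winsOne s m) :
    gameLength n s ≤ m := by
  obtain ⟨k, hk, hkn⟩ := exists_le_eq_of_le (winsOne_zero s)
    (fun m => by rw [winsOne_succ]; split_ifs <;> omega) h
  exact (Nat.sInf_le (Or.inl hkn)).trans hk

theorem gameLength_le_of_le_winsTwo {n m : ℕ} {s : ℕ → Bool} (h : n ≤ winsTwo s m) :
    gameLength n s ≤ m := by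
  obtain ⟨k, hk, hkn⟩ := exists_le_eq_of_le (winsTwo_zero s)
    (fun m => by rw [winsTwo_succ]; split_ifs <;> omega) h
  exact (Nat.sInf_le (Or.inr hkn)).trans hk

theorem gameLength_le (n : ℕ) (s : ℕ → Bool) : gameLength n s ≤ 2 * n - 1 := by
  obtain ⟨m, hm, h⟩ := exists_winner n s
  exact (Nat.sInf_le h).trans hm

/-- At the end of the game, one player has `n` wins and the other one has fewer. -/
theorem gameLength_cases {n : ℕ} (hn : 0 < n) (s : ℕ → Bool) :
    (PlayerOneWon n s ∧ winsOne s (gameLength n s) = n ∧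
        winsTwo s (gameLength n s) = loserWins n s ∧ loserWins n s < n ∧
        netProfit n s = n - loserWins n s) ∨
      (¬ PlayerOneWon n s ∧ winsTwo s (gameLength n s) = n ∧
        winsOne s (gameLength n s) = loserWins n s ∧ loserWins n s < n ∧
        netProfit n s = loserWins n s - n) := by
  have h1 := gameLength_spec n s
  have h2 := gameLength_le n s
  have h3 := winsOne_add_winsTwo s (gameLength n s)
  by_cases h : PlayerOneWon n s
  · have h' : winsOne s (gameLength n s) = n := h
    refine Or.inl ⟨h, h', ?_⟩
    simp only [netProfit, loserWins, if_pos h, and_true, true_and]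
    omega
  · have h' : winsOne s (gameLength n s) ≠ n := h
    refine Or.inr ⟨h, by omega, ?_⟩
    simp only [netProfit, loserWins, if_neg h, and_true, true_and]
    omega

/-- The game lasts `n + loserWins n s` rounds, so `k` fixes the last round, which has index `n + k -
1`. The two alternatives say who wins it. -/
theorem loserWins_eq_iff {n k : ℕ} (hk : k < n) (s : ℕ → Bool) :
    loserWins n s = k ↔
      (winsOne s (n + k - 1) = n - 1 ∧ s (n + k - 1) = true) ∨
        (winsOne s (n + k - 1) = k ∧ s (n + k - 1) = false) := by
  obtain ⟨m, hm⟩ : ∃ m, n + k = m + 1 := ⟨n + k - 1, by omega⟩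
  have hm' : n + k - 1 = m := by omega
  rw [hm']
  have hsum := winsOne_add_winsTwo s m
  have hsum' := winsOne_add_winsTwo s (m + 1)
  have hL := winsOne_add_winsTwo s (gameLength n s)
  have h1 := winsOne_succ s m
  have h2 := winsTwo_succ s m
  have hc := gameLength_cases (by omega : 0 < n) s
  have ha := @gameLength_le_of_le_winsOne n m s
  have hb := @gameLength_le_of_le_winsTwo n m s
  have ha' := @gameLength_le_of_le_winsOne n (m + 1) s
  have hb' := @gameLength_le_of_le_winsTwo n (m + 1) s
  constructor
  · intro hW
    have hLm : gameLength n s = m + 1 := by omega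
    rw [hLm] at hc ha hb
    cases hs : s m <;> simp only [hs] at * <;> grind
  · intro h
    have hLe : gameLength n s ≤ m + 1 := by
      rcases h with ⟨h, hs⟩ | ⟨h, hs⟩
      · apply ha'; simp only [hs, if_true] at h1; omega
      · apply hb'; simp only [hs] at h2; simp at h2; omega
    have hgt : m < gameLength n s := by
      by_contra hcon
      have h3 := winsOne_mono s (not_lt.1 hcon)
      have h4 := winsTwo_mono s (not_lt.1 hcon)
      omega
    have hLm : gameLength n s = m + 1 := by omega
    rw [hLm] at hc
    cases hs : s m <;> simp [hs] at * <;> omega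

/-- If Player 1 wins, the profit is `2 n` minus the game length, so a large profit means an early
`n`-th win. The guard `j ≤ n` matters only for `n = 0`, where the right-hand inequality is trivially
true. -/
theorem le_netProfit_iff {n j : ℕ} (hj : 0 < j) (s : ℕ → Bool) :
    (j : ℤ) ≤ netProfit n s ↔ j ≤ n ∧ n ≤ winsOne s (2 * n - j) := by
  rcases Nat.eq_zero_or_pos n with rfl | hn
  · have h1 := gameLength_le 0 s
    have h2 : gameLength 0 s = 0 := by omega
    simp [netProfit, loserWins, PlayerOneWon, h2, winsOne, winsTwo]
  have hL := winsOne_add_winsTwo s (gameLength n s)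
  have hm := winsOne_add_winsTwo s (2 * n - j)
  have hc := gameLength_cases hn s
  constructor
  · intro h
    have := winsOne_mono s (by omega : gameLength n s ≤ 2 * n - j)
    omega
  · rintro ⟨hjn, h⟩
    have := winsTwo_mono s (gameLength_le_of_le_winsOne h)
    omega

theorem netProfit_le_neg_iff {n j : ℕ} (hj : 0 < j) (s : ℕ → Bool) :
    netProfit n s ≤ -(j : ℤ) ↔ j ≤ n ∧ n ≤ winsTwo s (2 * n - j) := by
  rcases Nat.eq_zero_or_pos n with rfl | hn
  · have h1 := gameLength_le 0 s
    have h2 : gameLength 0 s = 0 := by omega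
    simp [netProfit, loserWins, PlayerOneWon, h2, winsOne, winsTwo]
  have hL := winsOne_add_winsTwo s (gameLength n s)
  have hm := winsOne_add_winsTwo s (2 * n - j)
  have hc := gameLength_cases hn s
  constructor
  · intro h
    have := winsTwo_mono s (by omega : gameLength n s ≤ 2 * n - j)
    omega
  · rintro ⟨hjn, h⟩
    have := winsOne_mono s (gameLength_le_of_le_winsTwo h)
    omega

/-- The event that the net profit is at least a nonpositive `-j`, in terms of the first
`2 n - 1 - j` rounds. -/
theorem neg_le_netProfit_iff {n j : ℕ} (hj : j < n) (s : ℕ → Bool) :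
    -(j : ℤ) ≤ netProfit n s ↔ n - j ≤ winsOne s (2 * n - (j + 1)) := by
  have h := @netProfit_le_neg_iff n (j + 1) (by omega) s
  have hm := winsOne_add_winsTwo s (2 * n - (j + 1))
  push_cast at h
  constructor
  · intro h'
    by_contra hcon
    have := h.2 (by omega)
    omega
  · intro h'
    by_contra hcon
    have := h.1 (by omega)
    omega

/-! ### Measurability, independence and the exact laws -/

section Coin

variable {Ω : Type*} [MeasurableSpace Ω] {P : Measure Ω} {p q : ℝ} {ξ : ℕ → Ω → Bool}

theorem measurable_winsOne (hmeas : ∀ i, Measurable (ξ i)) (m : ℕ) :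
    Measurable fun ω => winsOne (fun i => ξ i ω) m := by
  induction m with
  | zero => simp [winsOne_zero]
  | succ m ih =>
    simp only [winsOne_succ]
    exact ih.add ((measurable_of_countable fun b : Bool => if b = true then 1 else 0).comp (hmeas m))

theorem measurable_winsTwo (hmeas : ∀ i, Measurable (ξ i)) (m : ℕ) :
    Measurable fun ω => winsTwo (fun i => ξ i ω) m := by
  have h : ∀ ω, winsTwo (fun i => ξ i ω) m = m - winsOne (fun i => ξ i ω) m := fun ω => by
    have := winsOne_add_winsTwo (fun i => ξ i ω) m
    omega
  simp only [h]
  exact (measurable_of_countable fun a : ℕ => m - a).comp (measurable_winsOne hmeas m)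

theorem measurable_netProfit (hmeas : ∀ i, Measurable (ξ i)) (n : ℕ) :
    Measurable fun ω => netProfit n (fun i => ξ i ω) := by
  refine measurable_of_Ici fun j => ?_
  rcases lt_or_ge 0 j with hj | hj
  · obtain ⟨j, rfl⟩ := Int.eq_ofNat_of_zero_le hj.le
    have : (fun ω => netProfit n (fun i => ξ i ω)) ⁻¹' Ici (j : ℤ) =
        {ω | j ≤ n ∧ n ≤ winsOne (fun i => ξ i ω) (2 * n - j)} := by
      ext ω
      exact le_netProfit_iff (by exact_mod_cast hj) _
    rw [this]
    exact (MeasurableSet.const _).inter (measurable_winsOne hmeas _ measurableSet_Ici)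
  -- The complement of a profit of at least `j` is a profit of at most `j - 1 = -i`.
  · obtain ⟨i, hi⟩ := Int.eq_ofNat_of_zero_le (by omega : 0 ≤ 1 - j)
    have : (fun ω => netProfit n (fun i => ξ i ω)) ⁻¹' Ici j =
        {ω | i ≤ n ∧ n ≤ winsTwo (fun i => ξ i ω) (2 * n - i)}ᶜ := by
      ext ω
      have h := netProfit_le_neg_iff (n := n) (by omega : 0 < i) (fun i => ξ i ω)
      simp only [mem_preimage, mem_Ici, mem_compl_iff, mem_ofPred_eq, ← h]
      omega
    rw [this]
    exact ((MeasurableSet.const _).inter (measurable_winsTwo hmeas _ measurableSet_Ici)).compl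

theorem indepFun_winsOne (hmeas : ∀ i, Measurable (ξ i)) (hindep : iIndepFun ξ P) (m : ℕ) :
    IndepFun (fun ω => winsOne (fun i => ξ i ω) m) (ξ m) P := by
  have h := hindep.indepFun_finset (Finset.range m) {m} (by simp) hmeas
  -- The default `false` is never read, since `winsOne _ m` only inspects indices below `m`.
  have hφ : Measurable fun v : (Finset.range m → Bool) =>
      winsOne (fun i => if hi : i ∈ Finset.range m then v ⟨i, hi⟩ else false) m :=
    measurable_of_countable _
  have hψ : Measurable fun v : (({m} : Finset ℕ) → Bool) => v ⟨m, by simp⟩ :=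
    measurable_pi_apply _
  convert! h.comp hφ hψ using 1
  ext ω
  simp only [winsOne, Function.comp]
  congr 1
  refine Finset.filter_congr fun i hi => ?_
  simp only [dif_pos hi]

theorem measureReal_winsOne_and_eq (hmeas : ∀ i, Measurable (ξ i)) (hindep : iIndepFun ξ P)
    (m a : ℕ) (b : Bool) :
    P.real {ω | winsOne (fun i => ξ i ω) m = a ∧ ξ m ω = b} =
      P.real {ω | winsOne (fun i => ξ i ω) m = a} * P.real {ω | ξ m ω = b} := by
  have h := (indepFun_winsOne hmeas hindep m).measure_inter_preimage_eq_mul {a} {b}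
    (measurableSet_singleton _) (measurableSet_singleton _)
  simp only [measureReal_def, ← ENNReal.toReal_mul]
  exact congrArg ENNReal.toReal h

variable [IsProbabilityMeasure P]

theorem measureReal_eq_false (hmeas : ∀ i, Measurable (ξ i))
    (hprob : ∀ i, P.real {ω | ξ i ω = true} = p) (i : ℕ) :
    P.real {ω | ξ i ω = false} = 1 - p := by
  have h : {ω | ξ i ω = false} = {ω | ξ i ω = true}ᶜ := by ext; simp
  have hm : MeasurableSet {ω | ξ i ω = true} := hmeas i (measurableSet_singleton true)
  rw [h, probReal_compl_eq_one_sub hm, hprob]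

/-- The number of wins of Player 1 has a binomial distribution. -/
theorem measureReal_winsOne_eq (hmeas : ∀ i, Measurable (ξ i)) (hindep : iIndepFun ξ P)
    (hprob : ∀ i, P.real {ω | ξ i ω = true} = p) (a b : ℕ) :
    P.real {ω | winsOne (fun i => ξ i ω) (a + b) = a} =
      ((a + b).choose a : ℝ) * p ^ a * (1 - p) ^ b := by
  have hms : ∀ m a c, MeasurableSet {ω | winsOne (fun i => ξ i ω) m = a ∧ ξ m ω = c} :=
    fun m a c => (measurable_winsOne hmeas m (measurableSet_singleton a)).inter
      (hmeas m (measurableSet_singleton c))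
  obtain ⟨m, hm⟩ : ∃ m, m = a + b := ⟨_, rfl⟩
  induction m generalizing a b with
  | zero =>
    obtain ⟨rfl, rfl⟩ : a = 0 ∧ b = 0 := by omega
    simp [winsOne_zero]
  | succ m ih =>
    rw [← hm]
    have hfalse := measureReal_eq_false hmeas hprob m
    rcases a with _ | a
    · have hs : {ω | winsOne (fun i => ξ i ω) (m + 1) = 0} =
          {ω | winsOne (fun i => ξ i ω) m = 0 ∧ ξ m ω = false} := by
        ext ω
        simp [winsOne_succ]
      obtain rfl : b = m + 1 := by omega
      have h0 := ih 0 m (by omega)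
      rw [zero_add] at h0
      rw [hs, measureReal_winsOne_and_eq hmeas hindep, hfalse, h0]
      simp [pow_succ]
    · have hs : {ω | winsOne (fun i => ξ i ω) (m + 1) = a + 1} =
          {ω | winsOne (fun i => ξ i ω) m = a ∧ ξ m ω = true} ∪
            {ω | winsOne (fun i => ξ i ω) m = a + 1 ∧ ξ m ω = false} := by
        ext ω
        cases h : ξ m ω <;> simp [winsOne_succ, h]
      have hd : Disjoint {ω | winsOne (fun i => ξ i ω) m = a ∧ ξ m ω = true}
          {ω | winsOne (fun i => ξ i ω) m = a + 1 ∧ ξ m ω = false} := by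
        rw [Set.disjoint_left]
        rintro ω ⟨-, h⟩ ⟨-, h'⟩
        simp_all
      rw [hs, measureReal_union hd (hms _ _ _), measureReal_winsOne_and_eq hmeas hindep,
        measureReal_winsOne_and_eq hmeas hindep, hfalse, hprob]
      obtain rfl : m = a + b := by omega
      rw [ih a b rfl]
      rcases b with _ | b
      · have he : {ω | winsOne (fun i => ξ i ω) (a + 0) = a + 1} = ∅ := by
          ext ω
          have := winsOne_add_winsTwo (fun i => ξ i ω) (a + 0)
          simp only [mem_ofPred_eq, mem_empty_iff_false, iff_false]
          omega
        rw [he]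
        simp [pow_succ]
      · have h1 := ih (a + 1) b (by omega)
        rw [show a + 1 + b = a + (b + 1) by ring] at h1
        rw [h1, Nat.choose_succ_succ]
        push_cast
        ring

/-- The law of the number of rounds won by the loser. -/
theorem measureReal_loserWins_eq (hmeas : ∀ i, Measurable (ξ i)) (hindep : iIndepFun ξ P)
    (hprob : ∀ i, P.real {ω | ξ i ω = true} = p) {n k : ℕ} (hk : k < n) :
    P.real {ω | loserWins n (fun i => ξ i ω) = k} =
      ((n + k - 1).choose (n - 1) : ℝ) * (1 - p) ^ k * p ^ n +
        ((n + k - 1).choose (n - 1) : ℝ) * p ^ k * (1 - p) ^ n := by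
  have hs : {ω | loserWins n (fun i => ξ i ω) = k} =
      {ω | winsOne (fun i => ξ i ω) (n + k - 1) = n - 1 ∧ ξ (n + k - 1) ω = true} ∪
        {ω | winsOne (fun i => ξ i ω) (n + k - 1) = k ∧ ξ (n + k - 1) ω = false} := by
    ext ω
    exact loserWins_eq_iff hk _
  have hd : Disjoint
      {ω | winsOne (fun i => ξ i ω) (n + k - 1) = n - 1 ∧ ξ (n + k - 1) ω = true}
      {ω | winsOne (fun i => ξ i ω) (n + k - 1) = k ∧ ξ (n + k - 1) ω = false} := by
    rw [Set.disjoint_left]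
    rintro ω ⟨-, h⟩ ⟨-, h'⟩
    simp_all
  rw [hs, measureReal_union hd ((measurable_winsOne hmeas _ (measurableSet_singleton k)).inter
      (hmeas _ (measurableSet_singleton false))), measureReal_winsOne_and_eq hmeas hindep,
    measureReal_winsOne_and_eq hmeas hindep, hprob, measureReal_eq_false hmeas hprob]
  obtain ⟨n, rfl⟩ : ∃ r, n = r + 1 := ⟨n - 1, by omega⟩
  have h1 := measureReal_winsOne_eq hmeas hindep hprob n k
  have h2 := measureReal_winsOne_eq hmeas hindep hprob k n
  rw [show n + 1 + k - 1 = n + k by omega, Nat.add_sub_cancel, h1]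
  rw [add_comm k n, Nat.choose_symm_add.symm] at h2
  rw [h2]
  ring

end Coin

/-- Bounding the binomial coefficient by `2 ^ (n + k)` leaves the factor `(2 * p) ^ k`, which grows
with `k` because `2 * p ≥ 1`. -/
theorem choose_mul_pow_le {p q : ℝ} (hp : 1 / 2 ≤ p) (hq : 0 ≤ q) {n k : ℕ} (hk : k < n) :
    ((n + k - 1).choose (n - 1) : ℝ) * p ^ k * q ^ n ≤ (4 * p * q) ^ n := by
  have h1 : ((n + k - 1).choose (n - 1) : ℝ) ≤ 2 ^ (n + k) := by
    exact_mod_cast (Nat.choose_le_two_pow _ _).trans (Nat.pow_le_pow_right (by norm_num) (by omega))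
  have h2 : (2 * p) ^ k ≤ (2 * p) ^ n := pow_le_pow_right₀ (by linarith) hk.le
  calc ((n + k - 1).choose (n - 1) : ℝ) * p ^ k * q ^ n
      ≤ 2 ^ (n + k) * p ^ k * q ^ n := by gcongr
    _ = 2 ^ n * (2 * p) ^ k * q ^ n := by rw [mul_pow]; ring
    _ ≤ 2 ^ n * (2 * p) ^ n * q ^ n := by gcongr
    _ = (4 * p * q) ^ n := by rw [← mul_pow, ← mul_pow]; congr 1; ring

/-! ### Weak convergence tools -/

/-- Weak convergence on `ℝ` follows from convergence of the measures of all closed upper rays. -/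
theorem tendsto_probabilityMeasure_of_tendsto_Ici {ι : Type*} {l : Filter ι}
    [l.IsCountablyGenerated] {μ : ι → ProbabilityMeasure ℝ} {ν : ProbabilityMeasure ℝ}
    (h : ∀ x, Tendsto (fun i => (μ i : Measure ℝ).real (Ici x)) l
      (𝓝 ((ν : Measure ℝ).real (Ici x)))) :
    Tendsto μ l (𝓝 ν) := by
  -- Half-open intervals form a π-system with arbitrarily small neighbourhoods of each point, and
  -- the mass of each is a difference of two ray masses.
  refine (isPiSystem_Ico (id : ℝ → ℝ) (id : ℝ → ℝ)).tendsto_probabilityMeasure_of_tendsto_of_mem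
    ?_ ?_ ?_
  · rintro _ ⟨a, b, -, rfl⟩
    exact measurableSet_Ico
  · intro u hu x hx
    obtain ⟨a, b, hab, hsub⟩ := mem_nhds_iff_exists_Ioo_subset.1 (hu.mem_nhds hx)
    obtain ⟨c, hac, hcx⟩ := exists_between hab.1
    exact ⟨Ico c b, ⟨c, b, hcx.trans hab.2, rfl⟩, Ico_mem_nhds hcx hab.2,
      fun y hy => hsub ⟨hac.trans_le hy.1, hy.2⟩⟩
  · rintro _ ⟨a, b, hab, rfl⟩
    simp only [id] at hab
    have key : ∀ ρ : ProbabilityMeasure ℝ,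
        ((ρ (Ico a b) : NNReal) : ℝ) = (ρ : Measure ℝ).real (Ici a) - (ρ : Measure ℝ).real (Ici b) := by
      intro ρ
      have hs : Ico a b = Ici a \ Ici b := by ext; simp
      rw [← measureReal_sdiff (Ici_subset_Ici.2 hab.le) measurableSet_Ici, ← hs]
      rfl
    rw [← NNReal.tendsto_coe]
    simp only [id, key]
    exact (h a).sub (h b)

/-- If `Y m` converges in distribution to a standard Gaussian, then the probabilities that `Y m`
exceeds a convergent threshold converge. -/
theorem tendsto_measureReal_le_of_tendstoInDistribution {Ω : Type*} [MeasurableSpace Ω]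
    {P : Measure Ω} [IsProbabilityMeasure P] {Y : ℕ → Ω → ℝ}
    (hY : TendstoInDistribution Y atTop (id : ℝ → ℝ) (fun _ => P) (gaussianReal 0 1))
    {m : ℕ → ℕ} (hm : Tendsto m atTop atTop) {y : ℕ → ℝ} {x : ℝ} (hy : Tendsto y atTop (𝓝 x)) :
    Tendsto (fun n => P.real {ω | y n ≤ Y (m n) ω}) atTop (𝓝 ((gaussianReal 0 1).real (Ici x))) := by
  have h1 : TendstoInDistribution (fun n => Y (m n)) atTop (id : ℝ → ℝ) (fun _ => P)
      (gaussianReal 0 1) :=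
    ⟨fun n => hY.forall_aemeasurable _, hY.aemeasurable_limit, hY.tendsto.comp hm⟩
  -- Slutsky: subtracting `y n` turns the moving threshold into the fixed set `Ici 0`, whose
  -- frontier is null because the Gaussian has no atoms.
  have h2 : TendstoInMeasure P (fun n (_ : Ω) => - y n) atTop (fun _ => - x) :=
    tendstoInMeasure_of_tendsto_ae (fun n => aestronglyMeasurable_const)
      (ae_of_all _ fun _ => hy.neg)
  have h3 := h1.add_of_tendstoInMeasure_const h2 (fun n => aemeasurable_const)
  have hlim : ((gaussianReal 0 1).map fun ω => id ω + -x) (frontier (Ici 0)) = 0 := by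
    rw [frontier_Ici, Measure.map_apply (by fun_prop) (measurableSet_singleton _)]
    have : (fun ω : ℝ => id ω + -x) ⁻¹' {0} = {x} := by
      ext ω
      simp only [mem_preimage, mem_singleton_iff, id]
      constructor <;> intro h <;> linarith
    have := nullSingletonClass_gaussianReal (μ := 0) (v := 1) one_ne_zero
    simp_all
  have h4 := ProbabilityMeasure.tendsto_measure_of_null_frontier_of_tendsto' h3.tendsto hlim
  have := Measure.isProbabilityMeasure_map h3.aemeasurable_limit
  have h5 := (ENNReal.tendsto_toReal
    (measure_ne_top ((gaussianReal 0 1).map fun ω => id ω + -x) (Ici 0))).comp h4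
  convert! h5 using 1
  · ext n
    simp only [Function.comp, ProbabilityMeasure.coe_mk, measureReal_def]
    rw [Measure.map_apply_of_aemeasurable (h3.forall_aemeasurable n) measurableSet_Ici]
    congr 2
    ext ω
    simp
  · simp only [measureReal_def]
    rw [Measure.map_apply (by fun_prop) measurableSet_Ici]
    congr 3
    ext ω
    simp

/-! ### Central limit theorem for the number of wins -/

section Coin

variable {Ω : Type*} [MeasurableSpace Ω] {P : Measure Ω} [IsProbabilityMeasure P] {p : ℝ}
  {ξ : ℕ → Ω → Bool}

theorem integral_comp_coin (hmeas : ∀ i, Measurable (ξ i))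
    (hprob : ∀ i, P.real {ω | ξ i ω = true} = p) (g : Bool → ℝ) (i : ℕ) :
    ∫ ω, g (ξ i ω) ∂P = p * g true + (1 - p) * g false := by
  have : IsProbabilityMeasure (P.map (ξ i)) :=
    Measure.isProbabilityMeasure_map (hmeas i).aemeasurable
  rw [← integral_map (f := g) (hmeas i).aemeasurable (by fun_prop),
    integral_fintype Integrable.of_finite, Fintype.sum_bool,
    map_measureReal_apply (hmeas i) (measurableSet_singleton _),
    map_measureReal_apply (hmeas i) (measurableSet_singleton _)]
  have h1 := hprob i
  have h2 := measureReal_eq_false hmeas hprob i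
  simp only [smul_eq_mul]
  exact congrArg₂ (· + ·) (congrArg (· * _) h1) (congrArg (· * _) h2)

theorem identDistrib_coin (hmeas : ∀ i, Measurable (ξ i))
    (hprob : ∀ i, P.real {ω | ξ i ω = true} = p) (i : ℕ) : IdentDistrib (ξ i) (ξ 0) P P := by
  refine ⟨(hmeas i).aemeasurable, (hmeas 0).aemeasurable, ?_⟩
  have h : ∀ i, IsProbabilityMeasure (P.map (ξ i)) := fun i =>
    Measure.isProbabilityMeasure_map (hmeas i).aemeasurable
  refine Measure.ext_of_measureReal_singleton fun b => ?_
  rw [map_measureReal_apply (hmeas i) (measurableSet_singleton _),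
    map_measureReal_apply (hmeas 0) (measurableSet_singleton _)]
  cases b
  · exact (measureReal_eq_false hmeas hprob i).trans (measureReal_eq_false hmeas hprob 0).symm
  · exact (hprob i).trans (hprob 0).symm

/-- The central limit theorem of de Moivre and Laplace. -/
theorem tendstoInDistribution_winsOne (hmeas : ∀ i, Measurable (ξ i)) (hindep : iIndepFun ξ P)
    (hprob : ∀ i, P.real {ω | ξ i ω = true} = p) (hp0 : 0 < p) (hp1 : p < 1) :
    TendstoInDistribution
      (fun (m : ℕ) ω => (winsOne (fun i => ξ i ω) m - m * p) / (√m * √(p * (1 - p))))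
      atTop (id : ℝ → ℝ) (fun _ => P) (gaussianReal 0 1) := by
  have hpq : 0 < p * (1 - p) := mul_pos hp0 (by linarith)
  set g : Bool → ℝ := fun b => ((if b = true then 1 else 0) - p) / √(p * (1 - p)) with hg
  have hgm : Measurable g := measurable_of_finite g
  have h := tendstoInDistribution_inv_sqrt_mul_sum (P := P) (P' := gaussianReal 0 1)
    (Y := (id : ℝ → ℝ)) (X := fun i ω => g (ξ i ω)) ⟨by fun_prop, Measure.map_id⟩
    (by
      rw [integral_comp_coin hmeas hprob g 0]
      simp only [hg]
      simp
      ring)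
    (by
      have := integral_comp_coin hmeas hprob (fun b => g b ^ 2) 0
      simp only [Pi.pow_apply]
      rw [this]
      have hq0 : (1 - p) ≠ 0 := by linarith
      simp only [hg, div_pow, Real.sq_sqrt hpq.le]
      simp
      field_simp
      ring)
    (hindep.comp (fun _ => g) fun _ => hgm)
    (fun i => (identDistrib_coin hmeas hprob i).comp hgm)
  convert! h using 3 with m ω
  rw [winsOne_eq_sum, ← Finset.sum_div, Finset.sum_sub_distrib]
  simp only [Finset.sum_const, Finset.card_range, nsmul_eq_mul]
  rw [div_eq_mul_inv, mul_inv]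
  ring

end Coin

/-! ### Asymptotics of the integer threshold and the limit law -/

/-- Rounding up costs at most `p` in the numerator, negligible against `√n`. -/
theorem tendsto_ceil_sub_div_sqrt {p : ℝ} (hp : 0 < p) (c x : ℝ) :
    Tendsto (fun n : ℕ => (p * (⌈(c * n + x * √n) / p⌉ : ℝ) - c * n) / √n) atTop (𝓝 x) := by
  have hs : Tendsto (fun n : ℕ => √(n : ℝ)) atTop atTop :=
    Real.tendsto_sqrt_atTop.comp tendsto_natCast_atTop_atTop
  have hup : Tendsto (fun n : ℕ => x + p / √(n : ℝ)) atTop (𝓝 x) := by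
    simpa using tendsto_const_nhds.add (hs.const_div_atTop p)
  refine tendsto_of_tendsto_of_tendsto_of_le_of_le' tendsto_const_nhds hup ?_ ?_ <;>
    filter_upwards [eventually_gt_atTop 0] with n hn <;>
    have hn' : (0 : ℝ) < √n := Real.sqrt_pos.2 (by exact_mod_cast hn)
  · rw [le_div_iff₀ hn']
    have := (div_le_iff₀ hp).1 (Int.le_ceil ((c * n + x * √n) / p))
    linarith
  · rw [div_le_iff₀ hn', add_mul, div_mul_cancel₀ _ hn'.ne']
    have := (lt_div_iff₀ hp).1
      (sub_lt_iff_lt_add.2 (Int.ceil_lt_add_one ((c * n + x * √n) / p)))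
    linarith

theorem tendsto_ceil_div {p : ℝ} (hp : 0 < p) (c x : ℝ) :
    Tendsto (fun n : ℕ => (⌈(c * n + x * √n) / p⌉ : ℝ) / n) atTop (𝓝 (c / p)) := by
  have hs : Tendsto (fun n : ℕ => √(n : ℝ)) atTop atTop :=
    Real.tendsto_sqrt_atTop.comp tendsto_natCast_atTop_atTop
  have h := ((tendsto_ceil_sub_div_sqrt hp c x).mul hs.inv_tendsto_atTop).add_const c
    |>.div_const p
  rw [mul_zero, zero_add] at h
  refine h.congr' ?_
  filter_upwards [eventually_gt_atTop 0] with n hn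
  have hn' : (0 : ℝ) < √n := Real.sqrt_pos.2 (by exact_mod_cast hn)
  have hsq : (n : ℝ) = √n * √n := (Real.mul_self_sqrt (Nat.cast_nonneg n)).symm
  have hn0 : (n : ℝ) ≠ 0 := by positivity
  generalize (⌈(c * n + x * √n) / p⌉ : ℝ) = J
  simp only [Pi.inv_apply]
  rw [← div_eq_mul_inv, div_div, ← hsq]
  field_simp
  ring

/-- The event that the normalized net profit is at least `x` is eventually an event about the
number of wins of Player 1 after a deterministic number `m n` of rounds. -/
theorem exists_winsOne_threshold {p : ℝ} (hp : 1 / 2 ≤ p) (hp1 : p < 1) (x : ℝ) :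
    ∃ m t : ℕ → ℕ,
      (∀ᶠ n : ℕ in atTop, ∀ s : ℕ → Bool,
        x ≤ (p * (netProfit n s : ℝ) - (p - (1 - p)) * n) / √(n * (1 - p)) ↔
          t n ≤ winsOne s (m n)) ∧
      Tendsto (fun n => (m n : ℝ) / n) atTop (𝓝 p⁻¹) ∧
      Tendsto (fun n => ((t n : ℝ) - m n * p) / √n) atTop (𝓝 (x * √(1 - p))) := by
  have hp0 : 0 < p := by linarith
  have hq0 : 0 < 1 - p := by linarith
  set c := p - (1 - p) with hc
  -- The least integer profit whose normalized value is at least `x`.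
  set j : ℕ → ℤ := fun n => ⌈(c * n + x * √(1 - p) * √n) / p⌉ with hj
  have hj1 : Tendsto (fun n : ℕ => (p * (j n : ℝ) - c * n) / √n) atTop (𝓝 (x * √(1 - p))) :=
    tendsto_ceil_sub_div_sqrt hp0 c _
  have hj2 : Tendsto (fun n : ℕ => (j n : ℝ) / n) atTop (𝓝 (c / p)) :=
    tendsto_ceil_div hp0 c _
  have hinv : Tendsto (fun n : ℕ => (1 : ℝ) / n) atTop (𝓝 0) :=
    tendsto_const_div_atTop_nhds_zero_nat 1
  have hinv' : Tendsto (fun n : ℕ => (1 / 2 : ℝ) / √n) atTop (𝓝 0) :=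
    (Real.tendsto_sqrt_atTop.comp tendsto_natCast_atTop_atTop).const_div_atTop _
  have hevent : ∀ n : ℕ, 0 < n → ∀ s : ℕ → Bool,
      x ≤ (p * (netProfit n s : ℝ) - c * n) / √(n * (1 - p)) ↔ j n ≤ netProfit n s := by
    intro n hn s
    have hn' : (0 : ℝ) < n := by exact_mod_cast hn
    rw [le_div_iff₀ (Real.sqrt_pos.2 (mul_pos hn' hq0)), Real.sqrt_mul hn'.le, hj, Int.ceil_le,
      div_le_iff₀ hp0]
    constructor <;> intro h <;> linarith
  have hlt : ∀ᶠ n : ℕ in atTop, j n < n := by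
    have h1 : c / p < 1 := by rw [div_lt_one hp0]; linarith
    filter_upwards [hj2.eventually_lt_const h1, eventually_gt_atTop 0] with n h hn
    rw [div_lt_one (by exact_mod_cast hn)] at h
    exact_mod_cast h
  have hgt : ∀ᶠ n : ℕ in atTop, - j n < n := by
    have h1 : -1 < c / p := lt_of_lt_of_le (by norm_num) (div_nonneg (by linarith) hp0.le)
    filter_upwards [hj2.eventually_const_lt h1, eventually_gt_atTop 0] with n h hn
    rw [lt_div_iff₀ (by exact_mod_cast hn)] at h
    have h' : (-(n : ℤ) : ℝ) < j n := by push_cast; linarith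
    have : -(n : ℤ) < j n := by exact_mod_cast h'
    omega
  -- Only the fair game can have nonpositive thresholds for arbitrarily large `n`.
  have hpos : ∀ᶠ n : ℕ in atTop, 0 < j n ∨ c = 0 := by
    rcases (by linarith : 0 ≤ c).eq_or_lt with h0 | h0
    · exact Eventually.of_forall fun _ => Or.inr h0.symm
    · filter_upwards [hj2.eventually_const_lt (div_pos h0 hp0), eventually_gt_atTop 0] with n h hn
      rw [lt_div_iff₀ (by exact_mod_cast hn), zero_mul] at h
      exact Or.inl (by exact_mod_cast h)
  refine ⟨fun n => if 0 < j n then 2 * n - (j n).toNat else 2 * n - ((-j n).toNat + 1),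
    fun n => if 0 < j n then n else n - (-j n).toNat, ?_, ?_, ?_⟩
  · filter_upwards [hlt, hgt, eventually_gt_atTop 0] with n h1 h2 hn s
    rw [hevent n hn s]
    split_ifs with h
    · obtain ⟨i, hi⟩ := Int.eq_ofNat_of_zero_le h.le
      have := le_netProfit_iff (n := n) (by omega : 0 < i) s
      rw [hi, this, Int.toNat_natCast]
      omega
    · obtain ⟨i, hi⟩ := Int.eq_ofNat_of_zero_le (by omega : 0 ≤ - j n)
      have := neg_le_netProfit_iff (n := n) (by omega : i < n) s
      rw [hi, Int.toNat_natCast, ← this, ← hi, neg_neg]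
  · by_cases hc0 : c = 0
    · have hp2 : p⁻¹ = 2 := by
        rw [show p = 2⁻¹ by linarith, inv_inv]
      rw [hc0, zero_div] at hj2
      have h1 : Tendsto (fun n : ℕ => 2 - (j n : ℝ) / n) atTop (𝓝 p⁻¹) := by
        simpa [hp2] using hj2.const_sub 2
      have h2 : Tendsto (fun n : ℕ => 2 + (j n : ℝ) / n - 1 / n) atTop (𝓝 p⁻¹) := by
        simpa [hp2] using (hj2.const_add 2).sub hinv
      refine (h1.if' (p := fun n => 0 < j n) h2).congr' ?_
      filter_upwards [hlt, hgt, eventually_gt_atTop 0] with n h3 h4 hn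
      have hn0 : (n : ℝ) ≠ 0 := by positivity
      split_ifs with h
      · obtain ⟨i, hi⟩ := Int.eq_ofNat_of_zero_le h.le
        rw [hi, Int.toNat_natCast, Nat.cast_sub (by omega)]
        push_cast
        field_simp
      · obtain ⟨i, hi⟩ := Int.eq_ofNat_of_zero_le (by omega : 0 ≤ - j n)
        rw [hi, Int.toNat_natCast, Nat.cast_sub (by omega), show j n = -(i : ℤ) by omega]
        push_cast
        field_simp
        ring
    · have h1 : Tendsto (fun n : ℕ => 2 - (j n : ℝ) / n) atTop (𝓝 p⁻¹) := by
        -- Here `c = 2 * p - 1`.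
        have : p⁻¹ = 2 - c / p := by rw [hc]; field_simp; ring
        rw [this]
        exact hj2.const_sub 2
      refine h1.congr' ?_
      filter_upwards [hlt, hpos, eventually_gt_atTop 0] with n h3 h4 hn
      have hn0 : (n : ℝ) ≠ 0 := by positivity
      have h : 0 < j n := h4.resolve_right hc0
      obtain ⟨i, hi⟩ := Int.eq_ofNat_of_zero_le h.le
      rw [if_pos h, hi, Int.toNat_natCast, Nat.cast_sub (by omega)]
      push_cast
      field_simp
  -- For `j n > 0`, `t n - m n * p` is exactly `p * j n - c * n`. Otherwise `p = 1 / 2`, and the one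
  -- round fewer in `m n` adds `1 / 2`.
  · have h2 : Tendsto (fun n : ℕ => (p * (j n : ℝ) - c * n) / √n + (1 / 2) / √n) atTop
        (𝓝 (x * √(1 - p))) := by simpa using hj1.add hinv'
    refine (hj1.if' (p := fun n => 0 < j n) h2).congr' ?_
    filter_upwards [hlt, hgt, hpos, eventually_gt_atTop 0] with n h3 h4 h5 hn
    split_ifs with h
    · obtain ⟨i, hi⟩ := Int.eq_ofNat_of_zero_le h.le
      rw [hi, Int.toNat_natCast, Nat.cast_sub (by omega)]
      push_cast
      rw [hc]
      ring
    · obtain ⟨i, hi⟩ := Int.eq_ofNat_of_zero_le (by omega : 0 ≤ - j n)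
      have hc0 : c = 0 := h5.resolve_left h
      have hp2 : p = 1 / 2 := by linarith
      rw [hi, Int.toNat_natCast, Nat.cast_sub (by omega), Nat.cast_sub (by omega),
        show j n = -(i : ℤ) by omega, hc0, hp2]
      push_cast
      ring

theorem tendsto_measureReal_normalized_netProfit {Ω : Type*} [MeasurableSpace Ω] {P : Measure Ω}
    [IsProbabilityMeasure P] {p : ℝ} {ξ : ℕ → Ω → Bool} (hp : 1 / 2 ≤ p) (hp1 : p < 1)
    (hmeas : ∀ i, Measurable (ξ i)) (hindep : iIndepFun ξ P)
    (hprob : ∀ i, P.real {ω | ξ i ω = true} = p) (x : ℝ) :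
    Tendsto (fun n : ℕ => P.real {ω | x ≤ (p * (netProfit n (fun i => ξ i ω) : ℝ) -
        (p - (1 - p)) * n) / √(n * (1 - p))}) atTop (𝓝 ((gaussianReal 0 1).real (Ici x))) := by
  have hp0 : 0 < p := by linarith
  have hq0 : 0 < 1 - p := by linarith
  obtain ⟨m, t, hev, hm, ht⟩ := exists_winsOne_threshold hp hp1 x
  have hmtop : Tendsto m atTop atTop := by
    rw [← tendsto_natCast_atTop_iff (R := ℝ)]
    refine (hm.pos_mul_atTop (inv_pos.2 hp0) tendsto_natCast_atTop_atTop).congr' ?_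
    filter_upwards [eventually_gt_atTop 0] with n hn
    have hn0 : (n : ℝ) ≠ 0 := by positivity
    field_simp
  have hy : Tendsto (fun n => ((t n : ℝ) - m n * p) / (√(m n) * √(p * (1 - p)))) atTop (𝓝 x) := by
    -- The variance `m n * p * (1 - p)` is asymptotically `n * (1 - p)`, as `m n / n` tends to
    -- `p⁻¹`; this is the normalization in the statement.
    have hlim : x * √(1 - p) / (√p⁻¹ * √(p * (1 - p))) = x := by
      rw [← Real.sqrt_mul (inv_pos.2 hp0).le, inv_mul_cancel_left₀ hp0.ne',
        mul_div_cancel_right₀ _ (Real.sqrt_pos.2 hq0).ne']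
    have hden : √p⁻¹ * √(p * (1 - p)) ≠ 0 :=
      (mul_pos (Real.sqrt_pos.2 (inv_pos.2 hp0)) (Real.sqrt_pos.2 (mul_pos hp0 hq0))).ne'
    have h := ht.div (hm.sqrt.mul_const √(p * (1 - p))) hden
    rw [hlim] at h
    refine h.congr' ?_
    filter_upwards [eventually_gt_atTop 0] with n hn
    have hn0 : √(n : ℝ) ≠ 0 := (Real.sqrt_pos.2 (by exact_mod_cast hn)).ne'
    simp only [Pi.div_apply]
    rw [Real.sqrt_div (Nat.cast_nonneg _), div_div]
    congr 1
    field_simp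
  refine (tendsto_measureReal_le_of_tendstoInDistribution
    (tendstoInDistribution_winsOne hmeas hindep hprob hp0 hp1) hmtop hy).congr' ?_
  filter_upwards [hev, hmtop.eventually_gt_atTop 0] with n hn hmn
  congr 1
  ext ω
  have hpos : 0 < √(m n : ℝ) * √(p * (1 - p)) :=
    mul_pos (Real.sqrt_pos.2 (by exact_mod_cast hmn)) (Real.sqrt_pos.2 (mul_pos hp0 hq0))
  rw [mem_ofPred_eq, mem_ofPred_eq, hn, div_le_div_iff_of_pos_right hpos, sub_le_sub_iff_right,
    Nat.cast_le]

end FirstToWin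

theorem theorem2 {Ω : Type*} [MeasurableSpace Ω] (P : MeasureTheory.Measure Ω)
    [MeasureTheory.IsProbabilityMeasure P]
    (p q : ℝ) (hp : 1 / 2 ≤ p) (hp1 : p < 1) (hq : q = 1 - p)
    (ξ : ℕ → Ω → Bool) (hmeas : ∀ i, Measurable (ξ i))
    (hindep : ProbabilityTheory.iIndepFun ξ P)
    (hprob : ∀ i, P.real {ω | ξ i ω = true} = p) :
    (∀ n k : ℕ, k < n → ∃ α : ℝ,
      P.real {ω | FirstToWin.loserWins n (fun i => ξ i ω) = k}
          = ((n + k - 1).choose (n - 1) : ℝ) * q ^ k * p ^ n + α ∧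
        |α| ≤ (4 * p * q) ^ n) ∧
    MeasureTheory.TendstoInDistribution
      (fun (n : ℕ) (ω : Ω) =>
        (p * (FirstToWin.netProfit n (fun i => ξ i ω) : ℝ) - (p - q) * (n : ℝ)) / √((n : ℝ) * q))
      Filter.atTop (id : ℝ → ℝ) (fun _ => P) (ProbabilityTheory.gaussianReal 0 1) := by
  subst hq
  refine ⟨fun n k hk => ⟨((n + k - 1).choose (n - 1) : ℝ) * p ^ k * (1 - p) ^ n,
    FirstToWin.measureReal_loserWins_eq hmeas hindep hprob hk, ?_⟩, ?_⟩
  · have hp0 : 0 ≤ p := by linarith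
    have hq0 : 0 ≤ 1 - p := by linarith
    rw [abs_of_nonneg (by positivity)]
    exact FirstToWin.choose_mul_pow_le hp hq0 hk
  · have hm : ∀ n : ℕ, Measurable fun ω => (p * (FirstToWin.netProfit n (fun i => ξ i ω) : ℝ) -
        (p - (1 - p)) * (n : ℝ)) / √((n : ℝ) * (1 - p)) := fun n =>
      (measurable_of_countable fun z : ℤ =>
        (p * (z : ℝ) - (p - (1 - p)) * (n : ℝ)) / √((n : ℝ) * (1 - p))).comp
          (FirstToWin.measurable_netProfit hmeas n)
    refine ⟨fun n => (hm n).aemeasurable, aemeasurable_id,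
      FirstToWin.tendsto_probabilityMeasure_of_tendsto_Ici fun x => ?_⟩
    convert! FirstToWin.tendsto_measureReal_normalized_netProfit hp hp1 hmeas hindep hprob x
      using 2 with n
    · rw [MeasureTheory.ProbabilityMeasure.coe_mk,
        MeasureTheory.map_measureReal_apply (hm n) measurableSet_Ici]
      rfl
    · rw [MeasureTheory.ProbabilityMeasure.coe_mk, MeasureTheory.Measure.map_id]
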